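/- Let $G$ be a (discrete) virtually nilpotent group, i.e. $G$ has a nilpotent subgroup of finite index, and let $\pi$ be a unitary representation of $G$ on a complex Hilbert space $\mathcal H$. Call $L\subseteq G$ syndetic if $SL=G$ for some finite $S\subseteq G$, and thickly syndetic if $\bigcap_{g\in F}gL$ is syndetic for every finite $F\subseteq G$. Suppose that $\pi$ is weakly mixing, i.e. for all $\eta,\xi\in\mathcal H$ the coefficient $x\mapsto\langle\eta\mid\pi(x)\xi\rangle$ is a flight function: for every $\varepsilon>0$ the set $\{x\in G : |\langle\eta\mid\pi(x)\xi\rangle|\le\varepsilon\}$ is thickly syndetic. Then the reduced first cohomology of $\pi$ vanishes: $$\overline{H}^1(G,\pi)=Z^1(G,\pi)/\overline{B^1(G,\pi)}=0 .$$ Here $Z^1(G,\pi)$ is the space of cocycles, i.e. maps $b:G\to\mathcal H$ with $b(gh)=\pi(g)b(h)+b(g)$ for all $g,h\in G$, endowed with the topology of uniform convergence on compact (that is, finite) subsets of $G$, and $\overline{B^1(G,\pi)}$ is the closure in $Z^1(G,\pi)$ of the space $B^1(G,\pi)$ of coboundaries $g\mapsto\pi(g)\xi-\xi$, $\xi\in\mathcal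 H$. -/

import Mathlib

open scoped Pointwise

namespace ReducedCohomology

/-- A unitary representation of the (discrete) group `G` on the complex Hilbert space `H`:
a homomorphism into the group of surjective linear isometries, i.e. of unitary operators. -/
abbrev UnitaryRep (G : Type*) [Group G] (H : Type*) [NormedAddCommGroup H]
    [InnerProductSpace ℂ H] : Type _ :=
  G →* (H ≃ₗᵢ[ℂ] H)

/-! ### Flight functions and weak mixing -/

/-- `L ⊆ G` is syndetic if `S L = G` for some finite `S ⊆ G`. -/
def IsSyndetic {G : Type*} [Group G] (L : Set G) : Prop :=
  ∃ S : Finset G, (S : Set G) * L = Set.univ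

/-- `L ⊆ G` is thickly syndetic if `⋂ g ∈ F, g L` is syndetic for every finite `F ⊆ G`. -/
def IsThicklySyndetic {G : Type*} [Group G] (L : Set G) : Prop :=
  ∀ F : Finset G, IsSyndetic (⋂ g ∈ F, g • L)

/-- `f` is a flight function if `{x | |f x| ≤ ε}` is thickly syndetic for every `ε > 0`. -/
def IsFlightFunction {G : Type*} [Group G] (f : G → ℂ) : Prop :=
  ∀ ε : ℝ, 0 < ε → IsThicklySyndetic {x : G | ‖f x‖ ≤ ε}

/-- The coefficient `x ↦ ⟨η | π(x) ξ⟩` of the representation `π`. -/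
noncomputable def coefficient {G : Type*} [Group G] {H : Type*} [NormedAddCommGroup H]
    [InnerProductSpace ℂ H] (π : UnitaryRep G H) (η ξ : H) : G → ℂ :=
  fun x => @inner ℂ H InnerProductSpace.toInner η (π x ξ)

/-- `π` is weakly mixing if all its coefficients are flight functions. -/
def IsWeaklyMixing {G : Type*} [Group G] {H : Type*} [NormedAddCommGroup H]
    [InnerProductSpace ℂ H] (π : UnitaryRep G H) : Prop :=
  ∀ η ξ : H, IsFlightFunction (coefficient π η ξ)

/-! ### Reduced cohomology in degree one -/

/-- The space `Z¹(G, π)` of cocycles: maps `b : G → H` with `b (g h) = π(g) b(h) + b(g)`.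
As a subspace of the product `G → H` it carries the topology of pointwise convergence, which
is the topology of uniform convergence on compact sets, `G` being discrete. -/
def cocycles {G : Type*} [Group G] {H : Type*} [NormedAddCommGroup H]
    [InnerProductSpace ℂ H] (π : UnitaryRep G H) : Submodule ℂ (G → H) where
  carrier := {b | ∀ g h : G, b (g * h) = π g (b h) + b g}
  zero_mem' := by intro g h; simp
  add_mem' := by
    intro a b ha hb g h
    simp only [Pi.add_apply, ha g h, hb g h, map_add]
    abel
  smul_mem' := by
    intro c b hb g h
    simp only [Pi.smul_apply, hb g h, map_smul, smul_add]

/-- The coboundary map `d : H → Z¹(G, π)`, `(d ξ)(g) = π(g) ξ - ξ`. -/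
def coboundaryMap {G : Type*} [Group G] {H : Type*} [NormedAddCommGroup H]
    [InnerProductSpace ℂ H] (π : UnitaryRep G H) : H →ₗ[ℂ] cocycles π where
  toFun ξ := ⟨fun g => π g ξ - ξ, by
    intro g h
    simp [map_mul]⟩
  map_add' x y := by
    ext g
    simp only [map_add, Submodule.coe_add, Pi.add_apply]
    abel
  map_smul' c x := by
    ext g
    simp [smul_sub]

/-- The space `B¹(G, π)` of coboundaries, as a subspace of `Z¹(G, π)`. -/
def coboundaries {G : Type*} [Group G] {H : Type*} [NormedAddCommGroup H]
    [InnerProductSpace ℂ H] (π : UnitaryRep G H) : Submodule ℂ (cocycles π) :=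
  LinearMap.range (coboundaryMap π)

/-- The reduced cohomology in degree one: the quotient of `Z¹(G, π)` by the closure of
`B¹(G, π)` in `Z¹(G, π)`. -/
abbrev ReducedH1 {G : Type*} [Group G] {H : Type*} [NormedAddCommGroup H]
    [InnerProductSpace ℂ H] (π : UnitaryRep G H) : Type _ :=
  cocycles π ⧸ (coboundaries π).topologicalClosure

end ReducedCohomology

/-! Weak mixing leaves no nonzero vector fixed by a finite-index nilpotent subgroup `N`, and
averaging over cosets extends approximation by coboundaries from `N` to `G`. So let `G` be nilpotent
without fixed vectors. On a finite set `F`, let `η` be a limit of cocycles orthogonal to all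
coboundaries. For `z` central, `π z - 1` turns cocycles into coboundaries, so `(π z - 1) η` is both
a limit of cocycles and, by unitarity, orthogonal to them; hence it vanishes and `z` fixes `η`.
Climbing the upper central series, `G` fixes `η`, so `η = 0`. -/

namespace ReducedCohomology

open scoped InnerProductSpace

/-! ### Fixed vectors of normal subgroups and their projections -/

section Invariants

variable {G : Type*} [Group G] {H : Type*} [NormedAddCommGroup H] [InnerProductSpace ℂ H]

/-- The subspace of vectors fixed by the subgroup `N`. -/
def invariants (π : UnitaryRep G H) (N : Subgroup G) : Submodule ℂ H where
  carrier := {v | ∀ z ∈ N, π z v = v}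
  zero_mem' := by intro z _; simp
  add_mem' := by
    intro v w hv hw z hz
    rw [map_add, hv z hz, hw z hz]
  smul_mem' := by
    intro c v hv z hz
    rw [map_smul, hv z hz]

theorem mem_invariants {π : UnitaryRep G H} {N : Subgroup G} {v : H} :
    v ∈ invariants π N ↔ ∀ z ∈ N, π z v = v :=
  Iff.rfl

theorem map_mul_apply (π : UnitaryRep G H) (g h : G) (v : H) : π (g * h) v = π g (π h v) := by
  rw [map_mul]
  rfl

theorem isClosed_invariants (π : UnitaryRep G H) (N : Subgroup G) :
    IsClosed (invariants π N : Set H) := by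
  have : (invariants π N : Set H) = ⋂ z ∈ N, {v | π z v = v} := by
    ext v
    simp [mem_invariants]
  rw [this]
  exact isClosed_biInter fun z _ => isClosed_eq (π z).continuous continuous_id

instance [CompleteSpace H] (π : UnitaryRep G H) (N : Subgroup G) :
    CompleteSpace (invariants π N) :=
  (isClosed_invariants π N).completeSpace_coe

theorem invariants_anti (π : UnitaryRep G H) {M N : Subgroup G} (h : M ≤ N) :
    invariants π N ≤ invariants π M :=
  fun _ hv z hz => hv z (h hz)

theorem map_mem_invariants (π : UnitaryRep G H) {N : Subgroup G} [N.Normal] (g : G) {v : H}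
    (hv : v ∈ invariants π N) : π g v ∈ invariants π N := by
  intro z hz
  have h := hv (g⁻¹ * z * g) (by simpa using ‹N.Normal›.conj_mem z hz g⁻¹)
  calc π z (π g v) = π g (π (g⁻¹ * z * g) v) := by
        rw [← map_mul_apply, ← map_mul_apply]
        congr 2
        group
    _ = π g v := by rw [h]

theorem inner_map_left (π : UnitaryRep G H) (g : G) (v w : H) :
    ⟪π g v, w⟫_ℂ = ⟪v, π g⁻¹ w⟫_ℂ := by
  rw [← (π g⁻¹).inner_map_map (π g v) w, ← map_mul_apply, inv_mul_cancel,
    map_one]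
  rfl

theorem starProjection_map [CompleteSpace H] (π : UnitaryRep G H) {N : Subgroup G} [N.Normal]
    (g : G) (v : H) :
    (invariants π N).starProjection (π g v) = π g ((invariants π N).starProjection v) := by
  refine Submodule.eq_starProjection_of_mem_of_inner_eq_zero
    (map_mem_invariants π g (Submodule.starProjection_apply_mem (invariants π N) v))
    fun w hw => ?_
  rw [← map_sub, inner_map_left]
  exact Submodule.starProjection_inner_eq_zero v _ (map_mem_invariants π g⁻¹ hw)

theorem starProjection_map_of_mem [CompleteSpace H] (π : UnitaryRep G H) {N : Subgroup G}
    [N.Normal] {z : G} (hz : z ∈ N) (v : H) :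
    (invariants π N).starProjection (π z v) = (invariants π N).starProjection v := by
  rw [starProjection_map]
  exact Submodule.starProjection_apply_mem (invariants π N) v z hz

end Invariants

/-! ### Cocycles along the upper central series -/

section Cocycles

variable {G : Type*} [Group G] {H : Type*} [NormedAddCommGroup H] [InnerProductSpace ℂ H]

theorem cocycle_mul {π : UnitaryRep G H} {b : G → H} (hb : b ∈ cocycles π) (g h : G) :
    b (g * h) = π g (b h) + b g :=
  hb g h

theorem cocycle_one {π : UnitaryRep G H} {b : G → H} (hb : b ∈ cocycles π) : b 1 = 0 := by
  simpa using cocycle_mul hb 1 1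

theorem coboundary_mem_cocycles (π : UnitaryRep G H) (ξ : H) :
    (fun g => π g ξ - ξ) ∈ cocycles π :=
  (coboundaryMap π ξ).2

theorem starProjection_comp_mem_cocycles [CompleteSpace H] {π : UnitaryRep G H} {b : G → H}
    (hb : b ∈ cocycles π) (N : Subgroup G) [N.Normal] :
    (fun g => (invariants π N).starProjection (b g)) ∈ cocycles π := by
  intro g h
  simp only [cocycle_mul hb, map_add, starProjection_map]

/-- If `z` is central modulo `N`, the difference `π(z) b - b` is the coboundary of `b(z)` for
every `N`-invariant cocycle `b` that vanishes on `N`. -/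
theorem map_sub_eq_coboundary {π : UnitaryRep G H} {b : G → H} (hb : b ∈ cocycles π)
    {N : Subgroup G} (hbN : ∀ z ∈ N, b z = 0) (hbK : ∀ g, b g ∈ invariants π N) {z : G}
    (hz : ∀ g, z * g * z⁻¹ * g⁻¹ ∈ N) (g : G) :
    π z (b g) - b g = π g (b z) - b z := by
  have h : b (z * g) = b (g * z) := by
    have e : z * g = (z * g * z⁻¹ * g⁻¹) * (g * z) := by group
    rw [e, cocycle_mul hb, hbK _ _ (hz g), hbN _ (hz g), add_zero]
  rw [cocycle_mul hb, cocycle_mul hb] at h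
  rw [sub_eq_sub_iff_add_eq_add, h]

/-- This makes the projected cocycle descend modulo the `n`-th term, so that elements of the next
term act as if central. -/
theorem starProjection_cocycle_eq_zero [CompleteSpace H] {π : UnitaryRep G H}
    (hπ : invariants π ⊤ = ⊥) {b : G → H} (hb : b ∈ cocycles π) (n : ℕ) :
    ∀ z ∈ Subgroup.upperCentralSeries G n,
      (invariants π (Subgroup.upperCentralSeries G n)).starProjection (b z) = 0 := by
  induction n with
  | zero =>
    intro z hz
    rw [Subgroup.upperCentralSeries_zero, Subgroup.mem_bot] at hz
    rw [hz, cocycle_one hb, map_zero]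
  | succ n ih =>
    intro z hz
    set K := invariants π (Subgroup.upperCentralSeries G n)
    set K' := invariants π (Subgroup.upperCentralSeries G (n + 1))
    have hK : K' ≤ K := invariants_anti π (Subgroup.upperCentralSeries_mono G n.le_succ)
    have hKK (v : H) : K'.starProjection (K.starProjection v) = K'.starProjection v := by
      rw [← ContinuousLinearMap.comp_apply,
        Submodule.starProjection_comp_starProjection_of_le hK]
    have hinv : K'.starProjection (b z) ∈ invariants π ⊤ := by
      intro g _
      have h := map_sub_eq_coboundary (starProjection_comp_mem_cocycles hb _) ih
        (fun g => Submodule.starProjection_apply_mem _ _)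
        (Subgroup.mem_upperCentralSeries_succ_iff.1 hz) g
      -- Projecting to `K'` kills the left side, as `z` acts trivially there; what remains says that
      -- `g` fixes the projection of `b z`.
      have h' := congrArg K'.starProjection h
      rw [map_sub, map_sub, starProjection_map_of_mem π hz, sub_self, hKK,
        starProjection_map, hKK] at h'
      exact (sub_eq_zero.1 h'.symm)
    rwa [hπ, Submodule.mem_bot] at hinv

end Cocycles

section Coordinates

variable {ι : Type*} {H : Type*} [NormedAddCommGroup H] [InnerProductSpace ℂ H]

/-- Restriction of functions `ι → H` to a finite set, with values in a Hilbert space. -/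
def restrictFinset (F : Finset ι) : (ι → H) →ₗ[ℂ] PiLp 2 (fun _ : F => H) where
  toFun b := WithLp.toLp 2 fun i => b i
  map_add' _ _ := rfl
  map_smul' _ _ := rfl

@[simp]
theorem restrictFinset_apply (F : Finset ι) (b : ι → H) (i : F) :
    restrictFinset F b i = b i :=
  rfl

/-- An operator on `H` acting in each coordinate. -/
def coordinatewise (F : Finset ι) (T : H →L[ℂ] H) :
    PiLp 2 (fun _ : F => H) →L[ℂ] PiLp 2 (fun _ : F => H) :=
  (PiLp.continuousLinearEquiv 2 ℂ (fun _ : F => H)).symm.toContinuousLinearMap ∘L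
    ContinuousLinearMap.pi fun i => T ∘L PiLp.proj 2 (fun _ : F => H) i

@[simp]
theorem coordinatewise_apply (F : Finset ι) (T : H →L[ℂ] H) (x : PiLp 2 (fun _ : F => H))
    (i : F) : coordinatewise F T x i = T (x i) :=
  rfl

end Coordinates

/-! ### Nilpotent groups -/

section Nilpotent

variable {G : Type*} [Group G] {H : Type*} [NormedAddCommGroup H] [InnerProductSpace ℂ H]

/-- A limit of cocycles which is orthogonal to all coboundaries takes values in the vectors fixed
by the upper central series. -/
theorem mem_invariants_upperCentralSeries [CompleteSpace H] {π : UnitaryRep G H}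
    (hπ : invariants π ⊤ = ⊥) {F : Finset G} {η : PiLp 2 (fun _ : F => H)}
    (hη : η ∈ ((cocycles π).map (restrictFinset F)).topologicalClosure)
    (hη' : ∀ ξ, ⟪η, restrictFinset F fun g => π g ξ - ξ⟫_ℂ = 0) (n : ℕ) :
    ∀ g, η g ∈ invariants π (Subgroup.upperCentralSeries G n) := by
  induction n with
  | zero =>
    intro g z hz
    rw [Subgroup.upperCentralSeries_zero, Subgroup.mem_bot] at hz
    simp [hz]
  | succ n ih =>
    set M := (cocycles π).map (restrictFinset F)
    set K := invariants π (Subgroup.upperCentralSeries G n)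
    intro g z hz
    have key {b : G → H} (hb : b ∈ cocycles π) {z : G}
        (hz : z ∈ Subgroup.upperCentralSeries G (n + 1)) (g : G) :
        π z (K.starProjection (b g)) - K.starProjection (b g) =
          π g (K.starProjection (b z)) - K.starProjection (b z) :=
      map_sub_eq_coboundary (starProjection_comp_mem_cocycles hb _)
        (starProjection_cocycle_eq_zero hπ hb n)
        (fun g => Submodule.starProjection_apply_mem _ _)
        (Subgroup.mem_upperCentralSeries_succ_iff.1 hz) g
    set T : H →L[ℂ] H := (π z).toContinuousLinearEquiv.toContinuousLinearMap ∘L K.starProjection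
      - K.starProjection with hT
    have hTη (g : F) : coordinatewise F T η g = π z (η g) - η g := by
      simp [hT, Submodule.starProjection_eq_self_iff.2 (ih g)]
    have hmem : coordinatewise F T η ∈ M.topologicalClosure := by
      refine (map_mem_closure (coordinatewise F T).continuous hη ?_ :)
      rintro _ ⟨b, hb, rfl⟩
      refine ⟨_, coboundary_mem_cocycles π (K.starProjection (b z)), ?_⟩
      ext g
      exact (key hb hz g).symm
    -- Moving `T` to the other side replaces `z` by `z⁻¹` and turns the cocycle into a coboundary,
    -- which is orthogonal to `η`.
    have horth : coordinatewise F T η ∈ Mᗮ := by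
      rw [Submodule.mem_orthogonal']
      rintro _ ⟨b, hb, rfl⟩
      rw [← hη' (K.starProjection (b z⁻¹)), PiLp.inner_apply, PiLp.inner_apply]
      refine Finset.sum_congr rfl fun g _ => ?_
      rw [hTη, restrictFinset_apply, restrictFinset_apply, ← key hb (inv_mem hz), inner_sub_left,
        inner_map_left, ← inner_sub_right]
      nth_rw 1 [← Submodule.starProjection_eq_self_iff.2 (ih g)]
      rw [Submodule.inner_starProjection_left_eq_right, map_sub, starProjection_map]
    have hzero : coordinatewise F T η = 0 := by
      rw [← Submodule.orthogonal_closure] at horth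
      exact inner_self_eq_zero.1 (Submodule.inner_right_of_mem_orthogonal hmem horth)
    rw [← sub_eq_zero, ← hTη, hzero]
    rfl

/-- If a nilpotent group has no nonzero fixed vectors, every cocycle is a limit of
coboundaries. -/
theorem exists_coboundary_near_of_isNilpotent [CompleteSpace H] [Group.IsNilpotent G]
    {π : UnitaryRep G H} (hπ : invariants π ⊤ = ⊥) {b : G → H} (hb : b ∈ cocycles π)
    (F : Finset G) {ε : ℝ} (hε : 0 < ε) :
    ∃ ξ, ∀ g ∈ F, ‖b g - (π g ξ - ξ)‖ < ε := by
  set M := (cocycles π).map (restrictFinset F)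
  set B : Submodule ℂ (PiLp 2 (fun _ : F => H)) :=
    LinearMap.range (restrictFinset F ∘ₗ (cocycles π).subtype ∘ₗ coboundaryMap π)
  have hB : restrictFinset F b ∈ B.topologicalClosure := by
    rw [← Submodule.orthogonal_orthogonal_eq_closure, Submodule.mem_orthogonal]
    intro ψ hψ
    -- Projecting `ψ` to the closure of `M` keeps its pairings with cocycles and makes it a limit of
    -- cocycles.
    have hproj {y} (hy : y ∈ M) : ⟪M.topologicalClosure.starProjection ψ, y⟫_ℂ = ⟪ψ, y⟫_ℂ := by
      rw [Submodule.inner_starProjection_left_eq_right,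
        Submodule.starProjection_eq_self_iff.2 (M.le_topologicalClosure hy)]
    obtain ⟨n, hn⟩ := Group.IsNilpotent.nilpotent (G := G)
    have h := mem_invariants_upperCentralSeries hπ
      (Submodule.starProjection_apply_mem M.topologicalClosure ψ) (fun ξ => by
        rw [hproj (Submodule.mem_map_of_mem (coboundary_mem_cocycles π ξ))]
        exact Submodule.inner_left_of_mem_orthogonal (K := B) (LinearMap.mem_range_self _ ξ) hψ) n
    rw [hn, hπ] at h
    rw [← hproj (Submodule.mem_map_of_mem hb),
      show M.topologicalClosure.starProjection ψ = 0 from PiLp.ext h,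
      inner_zero_left]
  obtain ⟨_, ⟨ξ, rfl⟩, hξ⟩ := Metric.mem_closure_iff.1 hB ε hε
  refine ⟨ξ, fun g hg => lt_of_le_of_lt ?_ hξ⟩
  rw [dist_eq_norm]
  exact PiLp.norm_apply_le (restrictFinset F b - restrictFinset F fun g => π g ξ - ξ) ⟨g, hg⟩

end Nilpotent

/-! ### Passage to finite index -/

section FiniteIndex

variable {G : Type*} [Group G] {H : Type*} [NormedAddCommGroup H] [InnerProductSpace ℂ H]

/-- A cocycle that is a limit of coboundaries on a subgroup of finite index is a limit of
coboundaries. -/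
theorem exists_coboundary_near_of_finiteIndex {π : UnitaryRep G H} {N : Subgroup G}
    [N.FiniteIndex] {b : G → H} (hb : b ∈ cocycles π)
    (hN : ∀ (F : Finset N) (ε : ℝ), 0 < ε → ∃ ξ, ∀ g ∈ F, ‖b g - (π g ξ - ξ)‖ < ε)
    (F : Finset G) {ε : ℝ} (hε : 0 < ε) :
    ∃ ξ, ∀ g ∈ F, ‖b g - (π g ξ - ξ)‖ < ε := by
  classical
  have : Fintype (G ⧸ N) := Fintype.ofFinite _
  let t : G ⧸ N → G := Quotient.out
  have ht (g : G) (q : G ⧸ N) : (t (g • q))⁻¹ * (g * t q) ∈ N := by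
    rw [← QuotientGroup.eq, QuotientGroup.out_eq', ← smul_eq_mul,
      MulAction.Quotient.mk_smul_out]
  -- Approximate on the Schreier elements of `N` attached to `F`.
  obtain ⟨ξ, hξ⟩ := hN ((F ×ˢ (Finset.univ : Finset (G ⧸ N))).image
    fun p => ⟨_, ht p.1 p.2⟩) ε hε
  set c : G → H := b - fun g => π g ξ - ξ with hc_def
  have hc : c ∈ cocycles π := sub_mem hb (coboundary_mem_cocycles π ξ)
  set m : ℂ := (Fintype.card (G ⧸ N) : ℂ)
  have hm : m ≠ 0 := Nat.cast_ne_zero.2 Fintype.card_ne_zero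
  have hmul (g : G) (q : G ⧸ N) :
      π g (c (t q)) + c g = π (t (g • q)) (c ((t (g • q))⁻¹ * (g * t q))) + c (t (g • q)) := by
    rw [← cocycle_mul hc, ← cocycle_mul hc, mul_inv_cancel_left]
  -- Correcting by the mean of `c` over the transversal leaves as error a mean of translates of `c`
  -- at Schreier elements.
  refine ⟨ξ - m⁻¹ • ∑ q, c (t q), fun g hg => ?_⟩
  have hsum : m • c g + (π g (∑ q, c (t q)) - ∑ q, c (t q)) =
      ∑ q, π (t (g • q)) (c ((t (g • q))⁻¹ * (g * t q))) := by
    have h := Finset.sum_congr (rfl : (Finset.univ : Finset (G ⧸ N)) = _) fun q _ => hmul g q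
    have hperm : ∑ q, c (t (g • q)) = ∑ q, c (t q) :=
      Equiv.sum_comp (MulAction.toPerm g) fun q => c (t q)
    rw [Finset.sum_add_distrib, Finset.sum_add_distrib, hperm, Finset.sum_const, Finset.card_univ, ← map_sum,
      ← Nat.cast_smul_eq_nsmul ℂ] at h
    rw [← sub_eq_iff_eq_add.2 h]
    abel
  have heq : b g - (π g (ξ - m⁻¹ • ∑ q, c (t q)) - (ξ - m⁻¹ • ∑ q, c (t q))) =
      m⁻¹ • ∑ q, π (t (g • q)) (c ((t (g • q))⁻¹ * (g * t q))) := by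
    rw [← hsum, smul_add, inv_smul_smul₀ hm, hc_def]
    simp only [Pi.sub_apply, map_sub, map_smul, smul_sub]
    abel
  rw [heq, norm_smul, norm_inv, Complex.norm_natCast, inv_mul_lt_iff₀ (by positivity)]
  refine (norm_sum_le _ _).trans_lt ?_
  rw [← nsmul_eq_mul, ← Finset.card_univ, ← Finset.sum_const]
  refine Finset.sum_lt_sum_of_nonempty Finset.univ_nonempty fun q _ => ?_
  rw [LinearIsometryEquiv.norm_map]
  exact hξ ⟨_, ht g q⟩ (Finset.mem_image.2 ⟨(g, q), by simp [hg], rfl⟩)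

/-- A weakly mixing representation has no nonzero vectors fixed by a subgroup of finite
index. -/
theorem IsWeaklyMixing.invariants_eq_bot {π : UnitaryRep G H} (hπ : IsWeaklyMixing π)
    (N : Subgroup G) [N.FiniteIndex] : invariants π N = ⊥ := by
  classical
  have : Fintype (G ⧸ N) := Fintype.ofFinite _
  rw [Submodule.eq_bot_iff]
  intro v hv
  by_contra hv0
  have hpos : 0 < ‖v‖ ^ 2 := by positivity
  -- Syndetic sets are nonempty: some `x` has a small coefficient at `t⁻¹ * x` for every
  -- representative `t`. For the `t` representing `x N`, this element fixes `v`, so the coefficient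
  -- is `‖v‖ ^ 2`.
  obtain ⟨S, hS⟩ := hπ v v (‖v‖ ^ 2 / 2) (half_pos hpos)
    (Finset.univ.image (Quotient.out : G ⧸ N → G))
  obtain ⟨_, _, x, hx, _⟩ := Set.mem_mul.1 (hS ▸ Set.mem_univ (1 : G))
  simp only [Finset.mem_image, Finset.mem_univ, true_and, Set.iInter_exists,
    Set.iInter_iInter_eq', Set.mem_iInter] at hx
  have h := hx (x : G ⧸ N)
  rw [Set.mem_smul_set_iff_inv_smul_mem, smul_eq_mul, Set.mem_ofPred_eq, coefficient,
    hv _ (QuotientGroup.eq.1 (QuotientGroup.out_eq' (x : G ⧸ N))), inner_self_eq_norm_sq_to_K,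
    norm_pow] at h
  simp only [Complex.coe_algebraMap, Complex.norm_real, norm_norm] at h
  linarith

end FiniteIndex

theorem subsingleton_reducedH1 {G : Type*} [Group G] {H : Type*} [NormedAddCommGroup H]
    [InnerProductSpace ℂ H] {π : UnitaryRep G H}
    (h : ∀ b ∈ cocycles π, ∀ (F : Finset G) (ε : ℝ), 0 < ε →
      ∃ ξ, ∀ g ∈ F, ‖b g - (π g ξ - ξ)‖ < ε) :
    Subsingleton (ReducedH1 π) := by
  classical
  rw [Submodule.Quotient.subsingleton_iff, eq_top_iff]
  rintro ⟨b, hb⟩ -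
  -- The net is indexed by finite sets and precisions together.
  choose ξ hξ using fun p : Finset G × ℕ => h b hb p.1 (1 / ((p.2 : ℝ) + 1)) (by positivity)
  refine mem_closure_of_tendsto (f := fun p => coboundaryMap π (ξ p)) 
    (b := (Filter.atTop : Filter (Finset G × ℕ))) ?_
    (Filter.Eventually.of_forall fun p => ⟨ξ p, rfl⟩)
  rw [tendsto_subtype_rng, tendsto_pi_nhds]
  intro g
  rw [tendsto_iff_norm_sub_tendsto_zero]
  have hlim : Filter.Tendsto (fun p : Finset G × ℕ => 1 / ((p.2 : ℝ) + 1)) Filter.atTop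
      (nhds 0) := by
    rw [← Filter.prod_atTop_atTop_eq]
    exact tendsto_one_div_add_atTop_nhds_zero_nat.comp Filter.tendsto_snd
  refine squeeze_zero' (Filter.Eventually.of_forall fun p => norm_nonneg _) ?_ hlim
  filter_upwards [Filter.eventually_ge_atTop (({g}, 0) : Finset G × ℕ)] with p hp
  rw [norm_sub_rev]
  exact (hξ p g (hp.1 (Finset.mem_singleton_self g))).le

end ReducedCohomology

theorem mainTheorem12 {G : Type*} [Group G] (hG : Group.IsVirtuallyNilpotent G)
    {H : Type*} [NormedAddCommGroup H] [InnerProductSpace ℂ H] [CompleteSpace H]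
    (π : ReducedCohomology.UnitaryRep G H) (hπ : ReducedCohomology.IsWeaklyMixing π) :
    Subsingleton (ReducedCohomology.ReducedH1 π) := by
  obtain ⟨N, hN, hfin⟩ := hG
  refine ReducedCohomology.subsingleton_reducedH1 fun b hb F ε hε =>
    ReducedCohomology.exists_coboundary_near_of_finiteIndex (N := N) hb (fun F' δ hδ => ?_) F hε
  refine ReducedCohomology.exists_coboundary_near_of_isNilpotent (π := π.comp N.subtype)
    (b := fun g => b g) ?_ (fun g h => hb g h) F' hδ
  rw [eq_bot_iff, ← hπ.invariants_eq_bot N]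
  exact fun v hv z hz => hv ⟨z, hz⟩ trivial
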